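/- Let $p$ be a prime number, let $k$ be a perfect field of characteristic $p$, and let $G$ and $H$ be $k$-group schemes of finite type (not necessarily commutative, smooth or connected). For a $k$-scheme $X$, let $F_X\colon X\to X$ be its absolute Frobenius endomorphism (the identity on the underlying space and $s\mapsto s^p$ on sections), and let $$X^{\mathrm{pf}}=\varprojlim\big(\cdots\xrightarrow{F_X}X\xrightarrow{F_X}X\xrightarrow{F_X}X\big)$$ be its inverse perfection, regarded as a $k$-scheme via the projection $\phi_X\colon X^{\mathrm{pf}}\to X$ to the last term. Thus $X^{\mathrm{pf}}$ is perfect (its absolute Frobenius is an isomorphism), and every $k$-morphism from a perfect $k$-scheme to $X$ factors uniquely through $\phi_X$. The functor $X\mapsto X^{\mathrm{pf}}$ preserves finite products of $k$-schemes, so it takes $k$-group schemes to $k$-group schemes. Let $f\colon G\to H$ be an isogeny, i.e. a surjective homomorphism of $k$-group schemes whose scheme-theoretic kernel $\operatorname{Ker} f=G\times_H\operatorname{Spec}k$ is finite over $k$, and assume that $\operatorname{Ker} f$ is geometrically connected over $k$. Then $f^{\mathrm{pf}}\colon G^{\mathrm{pf}}\to H^{\mathrm{pf}}$ is an isomorphism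 of $k$-group schemes. -/

import Mathlib

open CategoryTheory Limits AlgebraicGeometry

universe u

namespace InversePerfection

variable (p : ℕ)

/-- A scheme is an `𝔽_p`-scheme if `p` vanishes on it. -/
class IsCharP (p : ℕ) (X : Scheme.{u}) : Prop where
  natCast_eq_zero : (p : Γ(X, ⊤)) = 0

lemma natCast_section_eq_zero (X : Scheme.{u}) [IsCharP p X] (U : X.Opens) :
    (p : Γ(X, U)) = 0 := by
  have h := congrArg (X.presheaf.map (homOfLE (le_top : U ≤ ⊤)).op).hom
    (IsCharP.natCast_eq_zero (p := p) (X := X))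
  simpa only [map_natCast, map_zero] using h

lemma isCharP_of_hom {X Y : Scheme.{u}} (f : X ⟶ Y) [IsCharP p Y] : IsCharP p X := by
  constructor
  have h := congrArg f.appTop.hom (IsCharP.natCast_eq_zero (p := p) (X := Y))
  rw [map_natCast, map_zero] at h
  exact h

variable [Fact p.Prime]

/-- The `p`-th power map of a ring in which `p = 0`. -/
def powHom (R : Type u) [CommRing R] (h : (p : R) = 0) : R →+* R where
  toFun x := x ^ p
  map_one' := one_pow p
  map_mul' x y := mul_pow x y p
  map_zero' := zero_pow (Fact.out : p.Prime).ne_zero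
  map_add' x y := by
    rcases subsingleton_or_nontrivial R with _ | _
    · exact Subsingleton.elim _ _
    · have : CharP R p := (CharP.charP_iff_prime_eq_zero Fact.out).mpr h
      exact add_pow_char x y p

/-- The absolute Frobenius endomorphism of an `𝔽_p`-scheme: the identity on the underlying space
and `s ↦ s ^ p` on sections. -/
noncomputable def absoluteFrobenius (X : Scheme.{u}) [IsCharP p X] : X ⟶ X :=
  ⟨{  base := 𝟙 _
      c := 
      { app := fun U ↦ CommRingCat.ofHom
          (powHom p Γ(X, U.unop) (natCast_section_eq_zero p X U.unop))
        naturality := fun U V i ↦ by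
          ext x
          exact (map_pow (X.presheaf.map i).hom x p).symm }
      prop := fun x ↦ by
        constructor
        intro a ha
        obtain ⟨U, hx, s, rfl⟩ := X.presheaf.exists_germ_eq a
        erw [PresheafedSpace.stalkMap_germ_apply] at ha
        have h : IsUnit ((X.presheaf.germ U x hx).hom (s ^ p)) := ha
        rw [map_pow] at h
        exact (isUnit_pow_iff (Fact.out : p.Prime).ne_zero).mp h }⟩


lemma absoluteFrobenius_app_apply (X : Scheme.{u}) [IsCharP p X] (U : X.Opens) (s : Γ(X, U)) :
    (absoluteFrobenius p X).app U s = s ^ p := rfl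

lemma absoluteFrobenius_preimage (X : Scheme.{u}) [IsCharP p X] (U : X.Opens) :
    absoluteFrobenius p X ⁻¹ᵁ U = U := rfl

/-- Every morphism of `𝔽_p`-schemes commutes with the absolute Frobenius endomorphisms. -/
lemma absoluteFrobenius_naturality {X Y : Scheme.{u}} [IsCharP p X] [IsCharP p Y] (f : X ⟶ Y) :
    f ≫ absoluteFrobenius p Y = absoluteFrobenius p X ≫ f := by
  refine Scheme.Hom.ext rfl fun U ↦ ?_
  refine (congrArg (_ ≫ ·) (X.presheaf.map_id _)).trans ?_
  ext s
  exact map_pow (f.app U).hom s p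


/-- The tower `⋯ ⟶ X ⟶ X ⟶ X` all of whose transition maps are the absolute Frobenius. -/
noncomputable def frobeniusTower (X : Scheme.{u}) [IsCharP p X] : ℕᵒᵖ ⥤ Scheme.{u} :=
  Functor.ofOpSequence (X := fun _ ↦ X) fun _ ↦ absoluteFrobenius p X

lemma frobeniusTower_map (X : Scheme.{u}) [IsCharP p X] (n : ℕ) :
    (frobeniusTower p X).map (homOfLE (Nat.le_add_right n 1)).op = absoluteFrobenius p X :=
  Functor.ofOpSequence_map_homOfLE_succ _ _

section

variable {p} {X Y Z : Scheme.{u}} [IsCharP p X] [IsCharP p Y]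

/-- The cone on the Frobenius tower given by a compatible sequence of morphisms. -/
noncomputable def towerCone (g : ℕ → (Z ⟶ Y)) (hg : ∀ n, g (n + 1) ≫ absoluteFrobenius p Y = g n) :
    Cone (frobeniusTower p Y) where
  pt := Z
  π := NatTrans.ofOpSequence (F := (Functor.const _).obj Z) g fun n ↦ by
    rw [frobeniusTower_map]
    exact (Category.id_comp _).trans (hg n).symm

lemma tower_w (c : Cone (frobeniusTower p Y)) (n : ℕ) :
    c.π.app ⟨n + 1⟩ ≫ absoluteFrobenius p Y = c.π.app ⟨n⟩ := by
  rw [← frobeniusTower_map p Y n]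
  exact c.w (homOfLE (Nat.le_add_right n 1)).op

lemma tower_apply (g : ℕ → (Z ⟶ Y)) (hg : ∀ n, g (n + 1) ≫ absoluteFrobenius p Y = g n)
    (n : ℕ) (z : Z) : (g n) z = (g 0) z := by
  induction n with
  | zero => rfl
  | succ n ih => rw [← ih, ← hg n]; rfl

variable (p Y) in
/-- A limit of the Frobenius tower, described by its universal property in terms of sequences. -/
structure TowerLimit where
  pt : Scheme.{u}
  π : ℕ → (pt ⟶ Y)
  w (n : ℕ) : π (n + 1) ≫ absoluteFrobenius p Y = π n
  exists_lift {Z : Scheme.{u}} (g : ℕ → (Z ⟶ Y))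
    (hg : ∀ n, g (n + 1) ≫ absoluteFrobenius p Y = g n) :
      ∃ h : Z ⟶ pt, ∀ n, h ≫ π n = g n
  hom_ext : ∀ {Z : Scheme.{u}} (_a _b : Z ⟶ pt), (∀ n, _a ≫ π n = _b ≫ π n) → _a = _b

namespace TowerLimit

/-- Limit cones give `TowerLimit`s. -/
def ofIsLimit {c : Cone (frobeniusTower p Y)} (hc : IsLimit c) : TowerLimit p Y where
  pt := c.pt
  π n := c.π.app ⟨n⟩
  w n := tower_w c n
  exists_lift g hg := ⟨hc.lift (towerCone g hg), fun n ↦ hc.fac (towerCone g hg) ⟨n⟩⟩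
  hom_ext a b h := hc.hom_ext fun ⟨n⟩ ↦ h n

/-- A `TowerLimit` gives a limit cone. -/
lemma hasLimit (L : TowerLimit p Y) : HasLimit (frobeniusTower p Y) := by
  have h (s : Cone (frobeniusTower p Y)) := L.exists_lift (fun n ↦ s.π.app ⟨n⟩) (tower_w s)
  choose l hl using h
  exact ⟨⟨towerCone L.π L.w, ⟨l, fun s ⟨n⟩ ↦ hl s n, fun s m hm ↦
    L.hom_ext _ _ fun n ↦ (hm ⟨n⟩).trans (hl s n).symm⟩⟩⟩

/-- The Frobenius tower of an affine scheme has a limit. -/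
lemma nonempty_of_isAffine [IsAffine Y] : Nonempty (TowerLimit p Y) := by
  let F : AffineScheme.of Y ⟶ AffineScheme.of Y := AffineScheme.ofHom (absoluteFrobenius p Y)
  let T : ℕᵒᵖ ⥤ AffineScheme.{u} := Functor.ofOpSequence 
    (X := fun _ ↦ AffineScheme.of Y) fun _ ↦ F
  have hT (n : ℕ) : T.map (homOfLE (Nat.le_add_right n 1)).op = F :=
    Functor.ofOpSequence_map_homOfLE_succ _ _
  let e : T ⋙ AffineScheme.forgetToScheme ⟶ frobeniusTower p Y :=
    NatTrans.ofOpSequence (fun _ ↦ 𝟙 Y) fun n ↦ by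
      rw [frobeniusTower_map, Functor.comp_map, hT]
      exact (Category.comp_id _).trans (Category.id_comp _).symm
  have he (n : ℕᵒᵖ) : IsIso (e.app n) := inferInstanceAs (IsIso (𝟙 Y))
  have : IsIso e := NatIso.isIso_of_isIso_app e
  have := preservesSmallestLimits_of_preservesLimits AffineScheme.forgetToScheme.{u}
  have : HasLimit (T ⋙ AffineScheme.forgetToScheme) :=
    ⟨⟨_, isLimitOfPreserves AffineScheme.forgetToScheme (limit.isLimit T)⟩⟩
  have : HasLimit (frobeniusTower p Y) := hasLimit_of_iso (asIso e)
  exact ⟨.ofIsLimit (limit.isLimit _)⟩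


lemma exists_map (L : TowerLimit p X) (M : TowerLimit p Y) (f : X ⟶ Y) :
    ∃ g : L.pt ⟶ M.pt, ∀ n, g ≫ M.π n = L.π n ≫ f :=
  M.exists_lift _ fun n ↦ by
    rw [Category.assoc, absoluteFrobenius_naturality, ← Category.assoc, L.w]

/-- A compatible sequence whose first term factors through an open subscheme lifts. -/
lemma exists_lift_of_isOpenImmersion (L : TowerLimit p X) (j : X ⟶ Y) [IsOpenImmersion j]
    (g : ℕ → (Z ⟶ Y)) (hg : ∀ n, g (n + 1) ≫ absoluteFrobenius p Y = g n)
    (a : Z ⟶ X) (ha : a ≫ j = g 0) : ∃ l : Z ⟶ L.pt, ∀ n, l ≫ L.π n ≫ j = g n := by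
  have hr (n : ℕ) : Set.range (g n) ⊆ Set.range j := by
    rintro _ ⟨z, rfl⟩
    rw [tower_apply g hg n z]
    refine ⟨a z, ?_⟩
    rw [← Scheme.Hom.comp_apply, ha]
  let h (n : ℕ) : Z ⟶ X := IsOpenImmersion.lift j (g n) (hr n)
  have hh (n : ℕ) : h n ≫ j = g n := IsOpenImmersion.lift_fac _ _ _
  have hw (n : ℕ) : h (n + 1) ≫ absoluteFrobenius p X = h n := by
    rw [← cancel_mono j, Category.assoc, ← absoluteFrobenius_naturality, reassoc_of% hh, hg, hh]
  obtain ⟨l, hl⟩ := L.exists_lift h hw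
  exact ⟨l, fun n ↦ by rw [reassoc_of% hl, hh]⟩

/-- The limit of the Frobenius tower is compatible with restriction to open subschemes. -/
lemma isPullback (L : TowerLimit p X) (M : TowerLimit p Y) (j : X ⟶ Y) [IsOpenImmersion j]
    (f : L.pt ⟶ M.pt) (hf : ∀ n, f ≫ M.π n = L.π n ≫ j) :
    IsPullback (L.π 0) f j (M.π 0) := by
  have key {Z : Scheme.{u}} (a : Z ⟶ X) (b : Z ⟶ M.pt) (hab : a ≫ j = b ≫ M.π 0) :
      ∃ l : Z ⟶ L.pt, l ≫ L.π 0 = a ∧ l ≫ f = b := by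
    obtain ⟨l, hl⟩ := L.exists_lift_of_isOpenImmersion j (fun n ↦ b ≫ M.π n)
      (fun n ↦ by rw [Category.assoc, M.w]) a hab
    refine ⟨l, ?_, M.hom_ext _ _ fun n ↦ ?_⟩
    · rw [← cancel_mono j, Category.assoc, hl, hab]
    · rw [Category.assoc, hf, hl]
  have : Mono f := ⟨fun a b hab ↦ L.hom_ext _ _ fun n ↦ by
    rw [← cancel_mono j, Category.assoc, Category.assoc, ← hf, reassoc_of% hab]⟩
  refine ⟨⟨(hf 0).symm⟩, ⟨PullbackCone.IsLimit.mk _ (fun s ↦ (key _ _ s.condition).choose)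
    (fun s ↦ (key _ _ s.condition).choose_spec.1) (fun s ↦ (key _ _ s.condition).choose_spec.2)
    fun s m _ h₂ ↦ ?_⟩⟩
  rw [← cancel_mono f, h₂, (key _ _ s.condition).choose_spec.2]

end TowerLimit

/-- The morphism of Frobenius towers induced by a morphism of schemes. -/
noncomputable def towerMap (f : X ⟶ Y) : frobeniusTower p X ⟶ frobeniusTower p Y :=
  NatTrans.ofOpSequence (fun _ ↦ f) fun n ↦ by
    rw [frobeniusTower_map, frobeniusTower_map]
    exact (absoluteFrobenius_naturality p f).symm

/-- Limits of Frobenius towers can be glued. -/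
lemma nonempty_towerLimit_of_cover (𝒰 : Y.OpenCover) [Category.{u} 𝒰.I₀] [𝒰.LocallyDirected]
    [Small.{u} 𝒰.I₀] [Quiver.IsThin 𝒰.I₀] [∀ i, IsAffine (𝒰.X i)] :
    Nonempty (TowerLimit p Y) := by
  have hp (i : 𝒰.I₀) : IsCharP p (𝒰.X i) := isCharP_of_hom p (𝒰.f i)
  let L (i : 𝒰.I₀) : TowerLimit p (𝒰.X i) := (TowerLimit.nonempty_of_isAffine).some
  choose t ht using fun (i j : 𝒰.I₀) (f : i ⟶ j) ↦ (L i).exists_map (L j) (𝒰.trans f)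
  let E : 𝒰.RelativeGluingData :=
    { functor :=
        { obj i := (L i).pt
          map f := t _ _ f
          map_id i := (L i).hom_ext _ _ fun n ↦ by simp [ht]
          map_comp f g := (L _).hom_ext _ _ fun n ↦ by simp [ht, reassoc_of% ht] }
      natTrans := 
        { app i := (L i).π 0
          naturality _ _ f := ht _ _ f 0 }
      equifibered {i j} f := ((L i).isPullback (L j) (𝒰.trans f) (t _ _ f) (ht _ _ f)).flip }
  have hE (E' : 𝒰.RelativeGluingData) : HasColimit E'.functor := inferInstance
  have := hE E
  have hι {i j : 𝒰.I₀} (f : i ⟶ j) : t _ _ f ≫ colimit.ι E.functor j = colimit.ι E.functor i :=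
    colimit.w E.functor f
  let π (n : ℕ) : E.glued ⟶ Y := colimit.desc E.functor
    { pt := Y
      ι := { app i := (L i).π n ≫ 𝒰.f i
             naturality i j f := by
              change t _ _ f ≫ _ ≫ _ = _ ≫ 𝟙 _
              rw [reassoc_of% ht, Category.comp_id, 𝒰.trans_map] } }
  have hπ (n : ℕ) (i : 𝒰.I₀) : colimit.ι E.functor i ≫ π n = (L i).π n ≫ 𝒰.f i :=
    colimit.ι_desc _ _
  have hπ₀ : π 0 = E.toBase := colimit.hom_ext fun i ↦ by
    rw [hπ, E.ι_toBase]; rfl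
  have hext {Z : Scheme.{u}} (a b : Z ⟶ E.glued) (h : ∀ n, a ≫ π n = b ≫ π n) : a = b := by
    refine Scheme.Cover.hom_ext (E.cover.pullback₁ a) _ _ fun (i : 𝒰.I₀) ↦ ?_
    change pullback.fst a (colimit.ι E.functor i) ≫ a = pullback.fst a (colimit.ι E.functor i) ≫ b
    have hc := pullback.condition (f := a) (g := colimit.ι E.functor i)
    have hP := E.isPullback_natTrans_ι_toBase i
    have hb : (pullback.snd a (colimit.ι E.functor i) ≫ (L i).π 0) ≫ 𝒰.f i =
        (pullback.fst a (colimit.ι E.functor i) ≫ b) ≫ E.toBase := by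
      rw [Category.assoc, Category.assoc, ← hπ₀, ← h, ← hπ, reassoc_of% hc]
    let l := hP.lift _ _ hb
    have hl : l ≫ colimit.ι E.functor i = pullback.fst a (colimit.ι E.functor i) ≫ b :=
      hP.lift_snd _ _ hb
    rw [hc, ← hl]
    congr 1
    refine (L i).hom_ext _ _ fun n ↦ ?_
    rw [← cancel_mono (𝒰.f i), Category.assoc, Category.assoc, ← hπ, ← reassoc_of% hc,
      reassoc_of% hl, h]
  refine ⟨⟨E.glued, π, fun n ↦ colimit.hom_ext fun (i : 𝒰.I₀) ↦ ?_, fun {Z} g hg ↦ ?_, hext⟩⟩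
  · rw [reassoc_of% hπ, hπ, absoluteFrobenius_naturality, ← Category.assoc, (L i).w]
  · have hZ (i : 𝒰.I₀) := (L i).exists_lift_of_isOpenImmersion (𝒰.f i)
      (fun n ↦ pullback.fst (g 0) (𝒰.f i) ≫ g n) (fun n ↦ by rw [Category.assoc, hg])
      (pullback.snd (g 0) (𝒰.f i)) pullback.condition.symm
    choose l hl using hZ
    have hl' (i : 𝒰.I₀) (n : ℕ) : (l i ≫ colimit.ι E.functor i) ≫ π n =
        pullback.fst (g 0) (𝒰.f i) ≫ g n := by
      rw [Category.assoc, hπ, hl]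
    let 𝒱 := 𝒰.pullback₁ (g 0)
    have hcomp (i j : 𝒰.I₀) : pullback.fst (𝒱.f i) (𝒱.f j) ≫ l i ≫ colimit.ι E.functor i =
        pullback.snd (𝒱.f i) (𝒱.f j) ≫ l j ≫ colimit.ι E.functor j := hext _ _ fun n ↦ by
      refine (Category.assoc _ _ _).trans ((congrArg _ (hl' i n)).trans ?_)
      refine .trans ?_ ((Category.assoc _ _ _).trans (congrArg _ (hl' j n))).symm
      exact pullback.condition_assoc (f := 𝒱.f i) (g := 𝒱.f j) (g n)
    refine ⟨Scheme.Cover.glueMorphisms 𝒱 (fun i ↦ l i ≫ colimit.ι E.functor i) hcomp, fun n ↦ ?_⟩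
    refine Scheme.Cover.hom_ext 𝒱 _ _ fun (i : 𝒰.I₀) ↦ ?_
    refine (Category.assoc _ _ _).symm.trans ?_
    exact (congrArg (· ≫ π n) (Scheme.Cover.ι_glueMorphisms 𝒱 _ hcomp i)).trans (hl' i n)

/-- The Frobenius tower of every `𝔽_p`-scheme has a limit. -/
lemma nonempty_towerLimit : Nonempty (TowerLimit p Y) := by
  have ha (i : Y.directedAffineCover.I₀) : IsAffine (Y.directedAffineCover.X i) := i.2
  have hs : Small.{u} Y.directedAffineCover.I₀ := inferInstanceAs (Small.{u} Y.affineOpens)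
  exact nonempty_towerLimit_of_cover Y.directedAffineCover

instance hasLimit_frobeniusTower : HasLimit (frobeniusTower p Y) :=
  (nonempty_towerLimit (p := p) (Y := Y)).some.hasLimit

end

/-- The inverse perfection `X^pf` of an `𝔽_p`-scheme `X`: the inverse limit of
`⋯ ⟶ X ⟶ X ⟶ X` along the absolute Frobenius. Over an affine open `Spec A` this is the spectrum of
the direct limit of `A ⟶ A ⟶ A ⟶ ⋯` along the Frobenius of `A`. -/
noncomputable def perf (X : Scheme.{u}) [IsCharP p X] : Scheme.{u} := limit (frobeniusTower p X)

namespace perf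

/-- The projection of the inverse limit `X^pf` to its `n`-th term. -/
noncomputable def proj (X : Scheme.{u}) [IsCharP p X] (n : ℕ) : perf p X ⟶ X :=
  limit.π (frobeniusTower p X) ⟨n⟩

variable {p} {X Y Z : Scheme.{u}} [IsCharP p X] [IsCharP p Y] [IsCharP p Z]

lemma proj_succ (n : ℕ) : proj p X (n + 1) ≫ absoluteFrobenius p X = proj p X n :=
  tower_w _ n

lemma hom_ext {W : Scheme.{u}} {a b : W ⟶ perf p X} (h : ∀ n, a ≫ proj p X n = b ≫ proj p X n) :
    a = b :=
  (TowerLimit.ofIsLimit (limit.isLimit (frobeniusTower p X))).hom_ext a b h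

lemma exists_lift {W : Scheme.{u}} (g : ℕ → (W ⟶ X))
    (hg : ∀ n, g (n + 1) ≫ absoluteFrobenius p X = g n) :
    ∃ h : W ⟶ perf p X, ∀ n, h ≫ proj p X n = g n :=
  (TowerLimit.ofIsLimit (limit.isLimit (frobeniusTower p X))).exists_lift g hg

/-- The morphism `f^pf : X^pf ⟶ Y^pf` induced by `f : X ⟶ Y`. -/
noncomputable def map (f : X ⟶ Y) : perf p X ⟶ perf p Y := limMap (towerMap f)

@[simp]
lemma map_proj (f : X ⟶ Y) (n : ℕ) : map f ≫ proj p Y n = proj p X n ≫ f :=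
  limMap_π (towerMap f) ⟨n⟩

@[simp]
lemma map_proj_assoc (f : X ⟶ Y) (n : ℕ) {W : Scheme.{u}} (h : Y ⟶ W) :
    map f ≫ proj p Y n ≫ h = proj p X n ≫ f ≫ h := by
  rw [← Category.assoc, map_proj, Category.assoc]

instance : IsCharP p (perf p X) := isCharP_of_hom p (proj p X 0)

/-- `X^pf` is a perfect scheme. -/
instance isIso_absoluteFrobenius : IsIso (absoluteFrobenius p (perf p X)) := by
  obtain ⟨s, hs⟩ := exists_lift (fun n ↦ proj p X (n + 1)) fun n ↦ proj_succ (n + 1)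
  have h : s ≫ absoluteFrobenius p (perf p X) = 𝟙 _ := hom_ext fun n ↦ by
    rw [Category.assoc, ← absoluteFrobenius_naturality, reassoc_of% hs, proj_succ, Category.id_comp]
  exact ⟨s, by rw [← absoluteFrobenius_naturality, h], h⟩

/-- Universal property of `X^pf`, uniqueness. -/
lemma hom_ext_of_isIso [IsIso (absoluteFrobenius p Z)] {a b : Z ⟶ perf p X}
    (h : a ≫ proj p X 0 = b ≫ proj p X 0) : a = b := by
  refine hom_ext fun n ↦ ?_
  induction n with
  | zero => exact h
  | succ n ih =>
    rw [← cancel_epi (absoluteFrobenius p Z), ← absoluteFrobenius_naturality,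
      ← absoluteFrobenius_naturality, Category.assoc, Category.assoc, proj_succ, ih]

/-- Universal property of `X^pf`, existence. -/
lemma exists_lift_of_isIso [IsIso (absoluteFrobenius p Z)] (f : Z ⟶ X) :
    ∃ h : Z ⟶ perf p X, h ≫ proj p X 0 = f := by
  let g : ℕ → (Z ⟶ X) := fun n ↦ Nat.rec f (fun _ g ↦ inv (absoluteFrobenius p Z) ≫ g) n
  have hg (n : ℕ) : g (n + 1) = inv (absoluteFrobenius p Z) ≫ g n := rfl
  obtain ⟨h, hh⟩ := exists_lift (p := p) g fun n ↦ by
    rw [hg, Category.assoc, absoluteFrobenius_naturality, IsIso.inv_hom_id_assoc]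
  exact ⟨h, hh 0⟩

end perf

section Over

open MonoidalCategory CartesianMonoidalCategory

variable (S : Scheme.{u}) [IsCharP p S]

instance isCharP_left (X : Over S) : IsCharP p X.left := isCharP_of_hom p X.hom

/-- The inverse perfection functor `X ↦ X^pf` on `S`-schemes. -/
noncomputable def perfection : Over S ⥤ Over S where
  obj X := Over.mk (perf.proj p X.left 0 ≫ X.hom)
  map f := Over.homMk (perf.map f.left) (by simp)
  map_id X := by
    ext1
    exact perf.hom_ext fun n ↦ by simp
  map_comp f g := by
    ext1
    exact perf.hom_ext fun n ↦ by simp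

/-- The canonical morphism `φ_X : X^pf ⟶ X`. -/
noncomputable def perfectionProj (X : Over S) : (perfection p S).obj X ⟶ X :=
  Over.homMk (perf.proj p X.left 0)

variable {S}

@[simp]
lemma perfection_map_proj {X Y : Over S} (f : X ⟶ Y) :
    (perfection p S).map f ≫ perfectionProj p S Y = perfectionProj p S X ≫ f := by
  ext1
  exact perf.map_proj f.left 0

instance (X : Over S) : IsIso (absoluteFrobenius p ((perfection p S).obj X).left) :=
  perf.isIso_absoluteFrobenius (X := X.left)

lemma perfection_hom_ext {Z X : Over S} [IsIso (absoluteFrobenius p Z.left)]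
    {a b : Z ⟶ (perfection p S).obj X}
    (h : a ≫ perfectionProj p S X = b ≫ perfectionProj p S X) : a = b := by
  ext1
  exact perf.hom_ext_of_isIso (congrArg (·.left) h)

lemma perfection_exists_lift {Z X : Over S} [IsIso (absoluteFrobenius p Z.left)] (f : Z ⟶ X) :
    ∃ h : Z ⟶ (perfection p S).obj X, h ≫ perfectionProj p S X = f := by
  obtain ⟨h, hh⟩ := perf.exists_lift_of_isIso (p := p) f.left
  refine ⟨Over.homMk h ?_, by ext1; exact hh⟩
  exact (Category.assoc _ _ _).symm.trans ((congrArg (· ≫ X.hom) hh).trans (Over.w f))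

variable [IsIso (absoluteFrobenius p S)]

instance (X Y : Over S) [IsIso (absoluteFrobenius p X.left)] [IsIso (absoluteFrobenius p Y.left)] :
    IsIso (absoluteFrobenius p (X ⊗ Y).left) := by
  have h : absoluteFrobenius p (X ⊗ Y).left = pullback.map X.hom Y.hom X.hom Y.hom
      (absoluteFrobenius p X.left) (absoluteFrobenius p Y.left) (absoluteFrobenius p S)
      (absoluteFrobenius_naturality p X.hom) (absoluteFrobenius_naturality p Y.hom) := by
    refine pullback.hom_ext ?_ ?_
    · rw [pullback.lift_fst]
      exact (absoluteFrobenius_naturality p (fst X Y).left).symm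
    · rw [pullback.lift_snd]
      exact (absoluteFrobenius_naturality p (snd X Y).left).symm
  rw [h]
  exact pullback.map_isIso ..

instance (X Y : Over S) : IsIso (CartesianMonoidalCategory.prodComparison (perfection p S) X Y) := by
  obtain ⟨g, hg⟩ := perfection_exists_lift (p := p)
    (perfectionProj p S X ⊗ₘ perfectionProj p S Y)
  have h₁ : CartesianMonoidalCategory.prodComparison (perfection p S) X Y ≫
      (perfectionProj p S X ⊗ₘ perfectionProj p S Y) = perfectionProj p S (X ⊗ Y) := by
    ext1 <;> simp
  have h₂ : CartesianMonoidalCategory.prodComparison (perfection p S) X Y ≫ g = 𝟙 _ :=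
    perfection_hom_ext p (by rw [Category.assoc, hg, h₁, Category.id_comp])
  refine ⟨g, h₂, ?_⟩
  refine CartesianMonoidalCategory.hom_ext _ _ ?_ ?_
  · refine perfection_hom_ext p ?_
    simp [reassoc_of% hg]
  · refine perfection_hom_ext p ?_
    simp [reassoc_of% hg]

instance : IsIso (CartesianMonoidalCategory.terminalComparison (perfection p S)) := by
  have : IsIso (absoluteFrobenius p (𝟙_ (Over S)).left) := ‹IsIso (absoluteFrobenius p S)›
  obtain ⟨g, hg⟩ := perfection_exists_lift (p := p) (𝟙 (𝟙_ (Over S)))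
  exact ⟨g, perfection_hom_ext p (toUnit_unique _ _), toUnit_unique _ _⟩

instance preservesFiniteProducts_perfection : PreservesFiniteProducts (perfection p S) :=
  have := preservesLimitsOfShape_discrete_walkingPair_of_isIso_prodComparison (perfection p S)
  have := preservesLimit_empty_of_isIso_terminalComparison (perfection p S)
  have := Limits.preservesLimitsOfShape_pempty_of_preservesTerminal (perfection p S)
  .of_preserves_binary_and_terminal _

/-- Over a perfect base, the inverse perfection functor is monoidal for the cartesian product, so
that it takes group schemes to group schemes. -/
noncomputable instance : (perfection p S).Monoidal :=
  Functor.Monoidal.ofChosenFiniteProducts _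

end Over

section Field

variable (k : Type u) [Field k] [CharP k p]

instance isCharP_spec : IsCharP p (Spec (.of k)) := by
  constructor
  have h := congrArg (Scheme.ΓSpecIso (.of k)).inv.hom (CharP.cast_eq_zero k p)
  rw [map_natCast, map_zero] at h
  exact h

instance [PerfectField k] : IsIso (absoluteFrobenius p (Spec (.of k))) := by
  have : PerfectRing k p := inferInstance
  have h : absoluteFrobenius p (Spec (.of k)) =
      Spec.map (frobeniusEquiv k p).toCommRingCatIso.hom := by
    refine ext_of_isAffine ?_
    rw [← cancel_epi (Scheme.ΓSpecIso (.of k)).inv, ← Scheme.ΓSpecIso_inv_naturality]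
    ext x
    exact (map_pow (Scheme.ΓSpecIso (.of k)).inv.hom x p).symm
  rw [h]
  infer_instance

end Field

section GroupScheme

open MonObj

variable {k : Type u} [Field k] {G H : Grp (Over (Spec (.of k)))}

/-- The scheme-theoretic kernel `G ×_H Spec k` of a homomorphism of `k`-group schemes `f : G ⟶ H`,
the fibre product being taken along `f` and the unit section of `H`. -/
noncomputable def kernelScheme (f : G ⟶ H) : Over (Spec (.of k)) :=
  Over.mk (pullback.snd f.hom.hom.left η[H.X].left)

/-- An isogeny is a surjective homomorphism of `k`-group schemes with finite kernel. -/
structure IsIsogeny (f : G ⟶ H) : Prop where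
  surjective : Surjective f.hom.hom.left
  finite_kernel : IsFinite (kernelScheme f).hom

end GroupScheme

end InversePerfection

open InversePerfection

/-!
The perfection `f^pf` of an isogeny `f : G ⟶ H` with connected kernel is shown to be a flat,
surjective, quasi-compact monomorphism of schemes; by fpqc descent such a morphism is an
isomorphism (`Flat.isIso_of_surjective_of_mono`).

*Monomorphism* (`mono_perf_map`). Fibre products of perfect schemes are perfect, so it suffices to
compare two morphisms `a`, `b` from a perfect scheme `P`, and by the universal property of the
perfection these may be taken with values in `G`. If `f a = f b`, then `a / b` factors through
`Ker f`. Being finite and connected over `k`, the kernel has only one point, and it has a section,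
the unit; since `P` is reduced, it has a single `k`-morphism to such a scheme. Hence `a = b`.

*Surjective* (`surjective_perf_map`). A point with values in an algebraically closed field lifts
to the perfection, because such a field is perfect.

*Flat* (`flat_of_surjective_of_isReduced`). Every surjective homomorphism `G ⟶ H` of group schemes
over a field with `H` reduced is flat, without any finiteness condition; this applies to
perfections, which are reduced. Indeed the local ring of `H` at a generic point `y` is a field, so
`U := G ×_H Spec 𝒪_{H, y}` is flat both over `G` and over `H`. The translates of `U` cover `G`: the
morphism `G × U ⟶ G`, `(a, c) ↦ a c`, is flat and surjective, and its composition with `f`, which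
is `(a, c) ↦ f(a) f(c)`, is flat for the same reason. Flatness of `f` follows by descent.

*Quasi-compact* (`quasiCompact_perf_map`). The projections `G^pf ⟶ G` and `H^pf ⟶ H` are affine, so
quasi-compactness of `f` is enough; it holds because `G` is quasi-compact and `H` is locally
noetherian.
-/

namespace InversePerfection

/-! ### Descent of flatness along flat surjective morphisms -/

open TensorProduct in
/-- Flatness of `A → C` descends to `A → B` when `C` is faithfully flat over `B`: for a linear map
`l` of `A`-modules, `C ⊗[B] (B ⊗[A] l)` is `C ⊗[A] l`. -/
lemma flat_of_faithfullyFlat_of_flat (A B C : Type*) [CommRing A] [CommRing B] [CommRing C]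
    [Algebra A B] [Algebra B C] [Algebra A C] [IsScalarTower A B C]
    [Module.FaithfullyFlat B C] [Module.Flat A C] : Module.Flat A B := by
  rw [Module.Flat.iff_lTensor_preserves_injective_linearMap]
  intro M N _ _ _ _ l hl
  have h : Function.Injective (l.lTensor C) := Module.Flat.lTensor_preserves_injective_linearMap l hl
  let l' : B ⊗[A] M →ₗ[B] B ⊗[A] N := l.baseChange B
  change Function.Injective l'
  rw [← Module.FaithfullyFlat.lTensor_injective_iff_injective B C l']
  let eM := AlgebraTensorModule.cancelBaseChange A B C C M
  let eN := AlgebraTensorModule.cancelBaseChange A B C C N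
  have hc : (l.lTensor C : C ⊗[A] M → C ⊗[A] N) ∘ eM = eN ∘ l'.lTensor C := by
    have : (l.baseChange C) ∘ₗ eM.toLinearMap =
        eN.toLinearMap ∘ₗ AlgebraTensorModule.lTensor C C l' := by
      ext
      simp [eM, eN, l']
    exact congrArg DFunLike.coe this
  exact (hc ▸ h.comp eM.injective).of_comp

lemma flat_of_flat_comp {W X Y : Scheme.{u}} (g : W ⟶ X) (f : X ⟶ Y) [Flat g] [Surjective g]
    [Flat (g ≫ f)] : Flat f := by
  refine Flat.of_stalkMap f fun x ↦ ?_
  obtain ⟨w, rfl⟩ := g.surjective x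
  have h₁ := Flat.stalkMap g w
  have h₂ := Flat.stalkMap (g ≫ f) w
  have hl : IsLocalHom (g.stalkMap w).hom := inferInstance
  rw [Scheme.Hom.stalkMap_comp] at h₂
  change RingHom.Flat ((g.stalkMap w).hom.comp (f.stalkMap (g w)).hom) at h₂
  generalize (f.stalkMap (g w)).hom = φ at h₂ ⊢
  generalize (g.stalkMap w).hom = ψ at h₁ h₂ hl
  algebraize [φ, ψ, ψ.comp φ]
  have : IsLocalHom (algebraMap (X.presheaf.stalk (g w)) (W.presheaf.stalk w)) := hl
  have := Module.FaithfullyFlat.of_flat_of_isLocalHom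
    (A := X.presheaf.stalk (g w)) (B := W.presheaf.stalk w)
  exact flat_of_faithfullyFlat_of_flat _ _ (W.presheaf.stalk w)

/-! ### Translates of flat morphisms -/

open MonoidalCategory CartesianMonoidalCategory MonObj

variable {S : Scheme.{u}}

section
variable {C : Type*} [Category* C] [CartesianMonoidalCategory C] {A H : C} [GrpObj H]

/-- The shear morphism `(x, h) ↦ (x, a(x) h)` is an isomorphism. -/
lemma isIso_lift_fst_mul_snd (a : A ⟶ H) : IsIso (lift (fst A H) (fst A H ≫ a * snd A H)) := by
  refine ⟨lift (fst A H) ((fst A H ≫ a)⁻¹ * snd A H), ?_, ?_⟩ <;>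
  ext <;> simp [comp_mul, GrpObj.comp_inv]

/-- The shear morphism `(h, x) ↦ (h a(x), x)` is an isomorphism. -/
lemma isIso_lift_mul_snd (a : A ⟶ H) : IsIso (lift (fst H A * (snd H A ≫ a)) (snd H A)) := by
  refine ⟨lift (fst H A * (snd H A ≫ a)⁻¹) (snd H A), ?_, ?_⟩ <;>
  ext <;> simp [comp_mul, GrpObj.comp_inv]

end

lemma isIso_left {X Y : Over S} (f : X ⟶ Y) [IsIso f] : IsIso f.left :=
  inferInstanceAs (IsIso ((Over.forget S).map f))

lemma isPullback_whiskerLeft_left (A : Over S) {V H : Over S} (v : V ⟶ H) :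
    IsPullback (A ◁ v).left (snd A V).left (snd A H).left v.left := by
  refine IsPullback.of_right (h₁₂ := (fst A H).left) (h₂₂ := H.hom) (v₁₃ := A.hom) ?_ ?_
    (IsPullback.of_hasPullback A.hom H.hom)
  · rw [← Over.comp_left, whiskerLeft_fst, Over.w]
    exact IsPullback.of_hasPullback A.hom V.hom
  · rw [← Over.comp_left, ← Over.comp_left, whiskerLeft_snd]

/-- The morphism `(x, y) ↦ a(x) v(y)` is flat: up to a shear automorphism of `A × H`, it is the
base change of `v` followed by the projection `A × H ⟶ H`. -/
lemma flat_fst_mul_snd {A V H : Over S} [GrpObj H] (a : A ⟶ H) (v : V ⟶ H) [Flat A.hom]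
    [Flat v.left] : Flat (fst A V ≫ a * snd A V ≫ v).left := by
  let e := lift (fst A H) (fst A H ≫ a * snd A H)
  have h : fst A V ≫ a * snd A V ≫ v = A ◁ v ≫ e ≫ snd A H := by simp [e, comp_mul]
  have := isIso_lift_fst_mul_snd a
  have h₁ : Flat (A ◁ v).left :=
    MorphismProperty.of_isPullback (isPullback_whiskerLeft_left A v).flip ‹_›
  have h₂ : Flat (snd A H).left := inferInstanceAs (Flat (pullback.snd A.hom H.hom))
  have h₃ : IsIso e.left := isIso_left e
  rw [h, Over.comp_left, Over.comp_left]
  exact MorphismProperty.comp_mem @Flat _ _ h₁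
    (MorphismProperty.comp_mem @Flat _ _ (inferInstance : Flat e.left) h₂)

/-- The translates of any `V ⟶ H` with `V` surjective over the base cover `H`: up to a shear
automorphism of `H × V`, the morphism `(h, y) ↦ h v(y)` is the first projection. -/
lemma surjective_fst_mul_snd {V H : Over S} [GrpObj H] (v : V ⟶ H) [Surjective V.hom] :
    Surjective (fst H V * snd H V ≫ v).left := by
  let e := lift (fst H V * (snd H V ≫ v)) (snd H V)
  have h : fst H V * snd H V ≫ v = e ≫ fst H V := by simp [e]
  have := isIso_lift_mul_snd v
  have h₁ : IsIso e.left := isIso_left e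
  have h₂ : Surjective (fst H V).left := inferInstanceAs (Surjective (pullback.fst H.hom V.hom))
  rw [h, Over.comp_left]
  have h₃ : Surjective e.left := inferInstance
  exact ⟨h₂.surj.comp h₃.surj⟩

/-- A homomorphism of group schemes is flat as soon as its restriction along one flat `u : U ⟶ G`
is flat, provided that `U` is surjective over the base: flatness spreads by translation. -/
lemma flat_of_isMonHom {G H U : Over S} [GrpObj G] [GrpObj H] (f : G ⟶ H) [IsMonHom f]
    [Flat G.hom] (u : U ⟶ G) [Surjective U.hom] [Flat u.left] [Flat (u ≫ f).left] :
    Flat f.left := by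
  let w := fst G U * snd G U ≫ u
  have h₁ : Flat w.left := by simpa [w] using flat_fst_mul_snd (𝟙 G) u
  have h₂ : Surjective w.left := surjective_fst_mul_snd u
  have h₃ : Flat (w.left ≫ f.left) := by
    have h := flat_fst_mul_snd f (u ≫ f)
    rwa [← Category.assoc, ← mul_comp, Over.comp_left] at h
  exact flat_of_flat_comp w.left f.left

/-! ### Surjective homomorphisms to reduced group schemes -/

section Field
variable {k : Type u} [Field k]

lemma flat_fromSpecStalk (X : Scheme.{u}) (x : X) : Flat (X.fromSpecStalk x) := by
  obtain ⟨_, ⟨U, hU, rfl⟩, hx, -⟩ := X.isBasis_affineOpens.exists_subset_of_mem_open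
    (Set.mem_univ x) isOpen_univ
  replace hU : IsAffineOpen U := hU
  rw [← hU.fromSpecStalk_eq_fromSpecStalk hx]
  have : Flat (Spec.map (X.presheaf.germ U x hx)) := by
    rw [Flat.SpecMap_iff]
    let _ : Algebra Γ(X, U) (X.presheaf.stalk x) := (X.presheaf.germ U x hx).hom.toAlgebra
    have := hU.isLocalization_stalk ⟨x, hx⟩
    exact IsLocalization.flat (R := Γ(X, U)) (X.presheaf.stalk x)
      (hU.primeIdealOf ⟨x, hx⟩).asIdeal.primeCompl
  exact inferInstanceAs (Flat (Spec.map (X.presheaf.germ U x hx) ≫ hU.fromSpec))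

lemma exists_isField_stalk (X : Scheme.{u}) [IsReduced X] [Nonempty X] :
    ∃ x : X, IsField (X.presheaf.stalk x) := by
  let x₀ : X := Classical.arbitrary X
  let Z := irreducibleComponent x₀
  have hZ : IsIrreducible Z := isIrreducible_irreducibleComponent
  refine ⟨hZ.genericPoint, isField_stalk_of_closure_mem_irreducibleComponents _ _ ?_⟩
  rw [hZ.closure_genericPoint isClosed_irreducibleComponent]
  exact irreducibleComponent_mem_irreducibleComponents x₀

/-- A surjective homomorphism from a group scheme to a reduced group scheme over a field is
flat. -/
lemma flat_of_surjective_of_isReduced {G H : Over (Spec (.of k))} [GrpObj G] [GrpObj H] (f : G ⟶ H)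
    [IsMonHom f] [Surjective f.left] [IsReduced H.left] : Flat f.left := by
  have : Nonempty H.left := ⟨η[H].left (default : Spec (.of k))⟩
  obtain ⟨y, hy⟩ : ∃ y : H.left, IsField (H.left.presheaf.stalk y) :=
    exists_isField_stalk H.left
  let g : G.left ⟶ H.left := f.left
  have : Surjective g := ‹_›
  let i : Spec (H.left.presheaf.stalk y) ⟶ H.left := H.left.fromSpecStalk y
  let _ : Field (H.left.presheaf.stalk y) := hy.toField
  have hs : Subsingleton (Spec (H.left.presheaf.stalk y)) :=
    PrimeSpectrum.subsingleton_iff_isField_of_isReduced.mpr hy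
  have : IsIntegral (Spec (H.left.presheaf.stalk y)) := inferInstance
  have : Flat i := flat_fromSpecStalk H.left y
  have : Nonempty (Spec (H.left.presheaf.stalk y)) := inferInstance
  have : Nonempty ↑(pullback g i) := (pullback.snd g i).surjective.nonempty
  -- `U = G ×_H Spec 𝒪_{H, y}` is flat over `G` since localizations are flat, and over `H` since
  -- `𝒪_{H, y}` is a field.
  let u : Over.mk (pullback.fst g i ≫ G.hom) ⟶ G := Over.homMk (pullback.fst g i)
  have : Flat u.left := inferInstanceAs (Flat (pullback.fst g i))
  have : Flat (u ≫ f).left := by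
    change Flat (pullback.fst g i ≫ g)
    rw [pullback.condition]
    infer_instance
  have : Nonempty (Over.mk (pullback.fst g i ≫ G.hom)).left :=
    inferInstanceAs (Nonempty ↑(pullback g i))
  have : Surjective (Over.mk (pullback.fst g i ≫ G.hom)).hom :=
    ⟨Function.surjective_to_subsingleton _⟩
  exact flat_of_isMonHom f u

end Field

/-! ### Perfect schemes and perfections -/

section
variable (p : ℕ) [Fact p.Prime]

/-- Perfect schemes are reduced, as the `p`-th power map is injective on their sections. -/
lemma isReduced_of_isIso_absoluteFrobenius (X : Scheme.{u}) [IsCharP p X]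
    [IsIso (absoluteFrobenius p X)] : IsReduced X := by
  refine ⟨fun U ↦ ⟨fun s hs ↦ ?_⟩⟩
  have hinj : Function.Injective (fun s : Γ(X, U) ↦ s ^ p) :=
    (ConcreteCategory.bijective_of_isIso ((absoluteFrobenius p X).app U)).1
  obtain ⟨n, hn⟩ := hs
  have hn' : s ^ p ^ n = 0 := pow_eq_zero_of_le (Nat.lt_pow_self (Fact.out : p.Prime).one_lt).le hn
  clear hn
  induction n with
  | zero => simpa using hn'
  | succ n ih =>
    refine ih (hinj ?_)
    simp only
    rw [← pow_mul, ← pow_succ, hn', zero_pow (Fact.out : p.Prime).ne_zero]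

instance isAffineHom_absoluteFrobenius (X : Scheme.{u}) [IsCharP p X] :
    IsAffineHom (absoluteFrobenius p X) := ⟨fun _ hU ↦ hU⟩

instance isAffineHom_frobeniusTower_map (X : Scheme.{u}) [IsCharP p X] {i j : ℕᵒᵖ} (h : i ⟶ j) :
    IsAffineHom ((frobeniusTower p X).map h) := by
  obtain ⟨i⟩ := i
  obtain ⟨j⟩ := j
  obtain ⟨n, rfl⟩ : ∃ n, i = j + n := Nat.exists_eq_add_of_le h.unop.le
  induction n with
  | zero =>
    have : h = 𝟙 _ := rfl
    rw [this, CategoryTheory.Functor.map_id]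
    infer_instance
  | succ n ih =>
    have : h = (homOfLE (Nat.le_add_right (j + n) 1)).op ≫
        (homOfLE (Nat.le_add_right j n)).op := rfl
    rw [this, Functor.map_comp, frobeniusTower_map]
    let g : X ⟶ X := (frobeniusTower p X).map (homOfLE (Nat.le_add_right j n)).op
    have : IsAffineHom g := ih (homOfLE (Nat.le_add_right j n)).op
    exact inferInstanceAs (IsAffineHom (absoluteFrobenius p X ≫ g))

instance isAffineHom_proj (X : Scheme.{u}) [IsCharP p X] (n : ℕ) :
    IsAffineHom (perf.proj p X n) := by
  -- `isAffineHom_π_app` takes index categories in the universe of the schemes, hence `AsSmall`.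
  let e : AsSmall.{u} ℕᵒᵖ ≌ ℕᵒᵖ := AsSmall.equiv.symm
  have h (i j : AsSmall.{u} ℕᵒᵖ) (f : i ⟶ j) :
      IsAffineHom ((e.functor ⋙ frobeniusTower p X).map f) :=
    isAffineHom_frobeniusTower_map p X _
  exact isAffineHom_π_app _ _ (IsLimit.whiskerEquivalence (limit.isLimit (frobeniusTower p X)) e)
    (AsSmall.up.obj (Opposite.op n))

lemma isIso_absoluteFrobenius_spec (K : Type u) [Field K] [PerfectField K]
    [IsCharP p (Spec (.of K))] : IsIso (absoluteFrobenius p (Spec (.of K))) := by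
  have h : (p : K) = 0 := by
    have := congrArg (Scheme.ΓSpecIso (.of K)).hom.hom
      (IsCharP.natCast_eq_zero (p := p) (X := Spec (.of K)))
    rwa [map_natCast, map_zero] at this
  have : CharP K p := (CharP.charP_iff_prime_eq_zero Fact.out).mpr h
  infer_instance

/-- Fibre products of perfect schemes are perfect. -/
lemma isIso_absoluteFrobenius_pullback {X Y Z : Scheme.{u}} [IsCharP p X] [IsCharP p Y]
    [IsCharP p Z] (f : X ⟶ Z) (g : Y ⟶ Z) [IsCharP p (pullback f g)]
    [IsIso (absoluteFrobenius p X)]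
    [IsIso (absoluteFrobenius p Y)] [IsIso (absoluteFrobenius p Z)] :
    IsIso (absoluteFrobenius p (pullback f g)) := by
  have h : absoluteFrobenius p (pullback f g) = pullback.map f g f g
      (absoluteFrobenius p X) (absoluteFrobenius p Y) (absoluteFrobenius p Z)
      (absoluteFrobenius_naturality p f) (absoluteFrobenius_naturality p g) := by
    refine pullback.hom_ext ?_ ?_
    · rw [pullback.lift_fst, absoluteFrobenius_naturality]
    · rw [pullback.lift_snd, absoluteFrobenius_naturality]
  rw [h]
  exact pullback.map_isIso ..

end

section
variable {p : ℕ} [Fact p.Prime]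

lemma surjective_perf_map {X Y : Scheme.{u}} [IsCharP p X] [IsCharP p Y] (f : X ⟶ Y)
    [Surjective f] : Surjective (perf.map (p := p) f) := by
  refine ⟨fun y ↦ ?_⟩
  -- A point `x` of `X` with `f(x)` the image of `y`, and a common extension `L` of the residue
  -- fields of `x` and `y`, come from a point of the fibre product `P`.
  let i := (perf p Y).fromSpecResidueField y
  let P := pullback f (i ≫ perf.proj p Y 0)
  obtain ⟨z⟩ : Nonempty P := (pullback.snd f (i ≫ perf.proj p Y 0)).surjective.nonempty
  let L := AlgebraicClosure (P.residueField z)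
  let t : Spec (.of L) ⟶ P :=
    Spec.map (CommRingCat.ofHom (algebraMap (P.residueField z) L)) ≫ P.fromSpecResidueField z
  let a : Spec (.of L) ⟶ X := t ≫ pullback.fst _ _
  let b : Spec (.of L) ⟶ perf p Y := (t ≫ pullback.snd _ _) ≫ i
  have : IsCharP p (Spec (.of L)) := isCharP_of_hom p a
  have := isIso_absoluteFrobenius_spec p L
  obtain ⟨c, hc⟩ := perf.exists_lift_of_isIso (p := p) a
  have h : c ≫ perf.map f = b := perf.hom_ext_of_isIso (p := p) (by
    rw [Category.assoc, perf.map_proj, reassoc_of% hc]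
    simp only [a, b, Category.assoc]
    rw [pullback.condition])
  let s : Spec (.of L) := Classical.arbitrary _
  refine ⟨c s, ?_⟩
  rw [← Scheme.Hom.comp_apply, h]
  have hs : b s ∈ Set.range i := ⟨(t ≫ pullback.snd _ _) s, rfl⟩
  rwa [Scheme.range_fromSpecResidueField] at hs

lemma quasiCompact_perf_map {X Y : Scheme.{u}} [IsCharP p X] [IsCharP p Y] (f : X ⟶ Y)
    [QuasiCompact f] : QuasiCompact (perf.map (p := p) f) := by
  have : QuasiCompact (perf.map (p := p) f ≫ perf.proj p Y 0) := by
    rw [perf.map_proj]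
    infer_instance
  exact QuasiCompact.of_comp _ (perf.proj p Y 0)

end

/-! ### The kernel of the isogeny -/

/-- Let `N` be an affine scheme with one point and `s` a section of `π : N ⟶ S`. Every morphism
from a reduced scheme to `N` factors through `s`: the functions on `N` that vanish on `s` vanish at
the only point of `N`, so their pullbacks to a reduced scheme are zero. -/
lemma eq_comp_section_of_isReduced {P N S : Scheme.{u}} [IsReduced P] [IsAffine N] [Subsingleton N]
    (π : N ⟶ S) (s : S ⟶ N) (hs : s ≫ π = 𝟙 S) [Nonempty S] (g : P ⟶ N) : g = g ≫ π ≫ s := by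
  refine ext_of_isAffine ?_
  ext a
  rw [← sub_eq_zero, Scheme.Hom.comp_appTop, CommRingCat.comp_apply, ← map_sub]
  set t := a - (π ≫ s).appTop a with ht
  have hst : s.appTop t = 0 := by
    rw [ht, map_sub, ← CommRingCat.comp_apply, ← Scheme.Hom.comp_appTop, ← Category.assoc, hs]
    simp
  have hN : N.basicOpen t = ⊥ := by
    let z : S := Classical.arbitrary S
    refine TopologicalSpace.Opens.ext (Set.eq_empty_of_forall_notMem fun x hx ↦ ?_)
    have hz : z ∈ s ⁻¹ᵁ N.basicOpen t := by
      rw [Subsingleton.elim x (s z)] at hx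
      exact hx
    have h0 : s.app ⊤ t = 0 := hst
    rw [Scheme.preimage_basicOpen, h0, Scheme.basicOpen_zero] at hz
    exact hz
  have h : P.basicOpen (g.app ⊤ t) = ⊥ := by
    rw [← Scheme.preimage_basicOpen, hN]
    rfl
  exact (basicOpen_eq_bot_iff _).mp h

section
variable {k : Type u} [Field k] {G H : Grp (Over (Spec (.of k)))}

/-- A finite geometrically connected kernel has only one point, since its fibre over the point of
`Spec k` is discrete. -/
lemma subsingleton_kernelScheme (f : G ⟶ H) [IsFinite (kernelScheme f).hom]
    [GeometricallyConnected (kernelScheme f).hom] : Subsingleton (kernelScheme f).left := by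
  have hc : ConnectedSpace (kernelScheme f).left :=
    GeometricallyConnected.connectedSpace_of_subsingleton (kernelScheme f).hom
  have hd : _root_.IsDiscrete ((kernelScheme f).hom ⁻¹' {default}) :=
    (kernelScheme f).hom.isDiscrete_preimage_singleton default
  have hu : (kernelScheme f).hom ⁻¹' {default} = Set.univ :=
    Set.eq_univ_of_forall fun _ ↦ Subsingleton.elim _ _
  rw [hu, isDiscrete_univ_iff] at hd
  exact PreconnectedSpace.trivial_of_discrete

/-- The kernel has no nontrivial points with values in a reduced `k`-scheme. -/
lemma eq_one_of_comp_eq_one (f : G ⟶ H) [IsFinite (kernelScheme f).hom]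
    [GeometricallyConnected (kernelScheme f).hom] {P : Over (Spec (.of k))} [IsReduced P.left]
    (c : P ⟶ G.X) (hc : c ≫ f.hom.hom = 1) : c = 1 := by
  have hone : (1 : P ⟶ G.X).left = P.hom ≫ η[G.X].left := by
    rw [Hom.one_def, Over.comp_left, Over.toUnit_left]
  have honeH : (1 : P ⟶ H.X).left = P.hom ≫ η[H.X].left := by
    rw [Hom.one_def, Over.comp_left, Over.toUnit_left]
  have hη : η[G.X].left ≫ f.hom.hom.left = η[H.X].left := by
    rw [← Over.comp_left, IsMonHom.one_hom]
  let N : Scheme.{u} := pullback f.hom.hom.left η[H.X].left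
  let π : N ⟶ Spec (.of k) := pullback.snd f.hom.hom.left η[H.X].left
  have : IsFinite π := ‹IsFinite (kernelScheme f).hom›
  have : Subsingleton N := subsingleton_kernelScheme f
  have : IsAffine N := isAffine_of_isAffineHom π
  let s : Spec (.of k) ⟶ N := pullback.lift η[G.X].left (𝟙 _) (by rw [hη, Category.id_comp])
  let g : P.left ⟶ N := pullback.lift c.left P.hom (by rw [← Over.comp_left, hc, honeH])
  have hg := eq_comp_section_of_isReduced π s (pullback.lift_snd _ _ _) g
  ext1
  have h := congrArg (· ≫ pullback.fst f.hom.hom.left η[H.X].left) hg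
  simp only [Category.assoc] at h
  rw [pullback.lift_fst, pullback.lift_fst, ← Category.assoc, pullback.lift_snd] at h
  rw [h, hone]

variable (p : ℕ) [Fact p.Prime] [CharP k p]

lemma mono_perf_map (f : G ⟶ H) [IsFinite (kernelScheme f).hom]
    [GeometricallyConnected (kernelScheme f).hom] : Mono (perf.map (p := p) f.hom.hom.left) := by
  let φ : perf p G.X.left ⟶ perf p H.X.left := perf.map f.hom.hom.left
  suffices h : pullback.fst φ φ = pullback.snd φ φ from
    ⟨fun a b hab ↦ by
      rw [← pullback.lift_fst a b hab, h, pullback.lift_snd]⟩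
  have : IsCharP p (pullback φ φ) := isCharP_of_hom p (pullback.fst φ φ)
  have := isIso_absoluteFrobenius_pullback p φ φ
  have := isReduced_of_isIso_absoluteFrobenius p (pullback φ φ)
  -- `pullback φ φ` is perfect, so its two projections may be compared after composing with
  -- `G^pf ⟶ G`, where their quotient is a point of the kernel.
  refine perf.hom_ext_of_isIso (p := p) ?_
  have hw : (pullback.fst φ φ ≫ perf.proj p _ 0) ≫ f.hom.hom.left =
      (pullback.snd φ φ ≫ perf.proj p _ 0) ≫ f.hom.hom.left := by
    rw [Category.assoc, Category.assoc, ← perf.map_proj, pullback.condition_assoc]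
  let P : Over (Spec (.of k)) := Over.mk ((pullback.fst φ φ ≫ perf.proj p _ 0) ≫ G.X.hom)
  let a : P ⟶ G.X := Over.homMk (pullback.fst φ φ ≫ perf.proj p _ 0)
  let b : P ⟶ G.X := Over.homMk (pullback.snd φ φ ≫ perf.proj p _ 0) (by
    change _ = (pullback.fst φ φ ≫ perf.proj p _ 0) ≫ G.X.hom
    rw [← Over.w f.hom.hom, ← Category.assoc, ← hw, Category.assoc])
  have hab : a ≫ f.hom.hom = b ≫ f.hom.hom := by
    ext1
    exact hw
  have : IsReduced P.left := ‹IsReduced (pullback φ φ)›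
  have h := eq_one_of_comp_eq_one f (a / b) (by rw [GrpObj.div_comp, hab, div_self'])
  exact congrArg (·.left) (div_eq_one.mp h)

end

end InversePerfection

theorem mainTheorem4 (p : ℕ) [Fact p.Prime] (k : Type u) [Field k] [CharP k p] [PerfectField k]
    (G H : Grp (Over (Spec (.of k))))
    [LocallyOfFiniteType G.X.hom] [QuasiCompact G.X.hom]
    [LocallyOfFiniteType H.X.hom] [QuasiCompact H.X.hom]
    (f : G ⟶ H) (hf : IsIsogeny f) (hker : GeometricallyConnected (kernelScheme f).hom) :
    IsIso ((perfection p (Spec (.of k))).mapGrp.map f) := by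
  have := hf.finite_kernel
  have := hf.surjective
  let F := (perfection p (Spec (.of k))).mapGrp.map f
  have : Mono F.hom.hom.left := mono_perf_map p f
  have : Surjective F.hom.hom.left := surjective_perf_map f.hom.hom.left
  -- `H` is locally noetherian, hence quasi-separated over `k`.
  have : QuasiCompact f.hom.hom.left := by
    have : IsLocallyNoetherian H.X.left := LocallyOfFiniteType.isLocallyNoetherian H.X.hom
    have : QuasiCompact (f.hom.hom.left ≫ H.X.hom) := by
      rw [Over.w]
      infer_instance
    exact QuasiCompact.of_comp _ H.X.hom
  have : QuasiCompact F.hom.hom.left := quasiCompact_perf_map f.hom.hom.left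
  have : IsReduced ((perfection p (Spec (.of k))).mapGrp.obj H).X.left :=
    isReduced_of_isIso_absoluteFrobenius p (perf p H.X.left)
  have : Flat F.hom.hom.left := flat_of_surjective_of_isReduced F.hom.hom
  have : IsIso F.hom.hom.left := Flat.isIso_of_surjective_of_mono _
  have : IsIso ((Over.forget _).map F.hom.hom) := ‹IsIso F.hom.hom.left›
  have : IsIso F.hom.hom := isIso_of_reflects_iso F.hom.hom (Over.forget _)
  exact (Grp.mkIso' (asIso F.hom.hom)).isIso_hom
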